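/- Let $H$ be a finite multigraph (parallel edges and loops allowed, a loop contributing $2$ to the degree of its vertex) that is cubic, i.e. every vertex has degree $3$, and $2$-edge-connected, i.e. it has at least two vertices, and it is connected and stays connected after the removal of any single edge. Let $S_2$ denote the multigraph consisting of two vertices joined by three parallel edges. If $H$ is not isomorphic to $S_2$, $K_4$ or $K_{3,3}$, then $H$ is decomposable; that is, $H$ has a separating matching: a set $M$ of pairwise non-adjacent non-loop edges such that $H - M$ has more connected components than $H$. -/

import Mathlib

open scoped Graph

namespace Graph

/-- The degree of a vertex of a multigraph: the number of incident edges, loops counted twice. -/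
noncomputable def edegree {α β : Type*} (G : Graph α β) (x : α) : ℕ∞ :=
  (G.incidenceSet x).encard + (G.loopSet x).encard

/-- Every vertex has degree three. -/
def IsCubic {α β : Type*} (G : Graph α β) : Prop :=
  ∀ x ∈ V(G), G.edegree x = 3

/-- `y` can be reached from `x` along a walk (possibly of length zero). -/
def Reachable {α β : Type*} (G : Graph α β) (x y : α) : Prop :=
  Relation.ReflTransGen G.Adj x y

/-- A connected multigraph is nonempty and any two vertices are joined by a walk. -/
def IsConnected {α β : Type*} (G : Graph α β) : Prop :=
  V(G).Nonempty ∧ ∀ x ∈ V(G), ∀ y ∈ V(G), G.Reachable x y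

/-- The connected components, given by their vertex sets. -/
def components {α β : Type*} (G : Graph α β) : Set (Set α) :=
  {C | ∃ x ∈ V(G), C = {y | G.Reachable x y}}

/-- `k`-edge-connected: more than one vertex, and the graph stays connected when fewer
than `k` edges are deleted. -/
def IsEdgeConnected {α β : Type*} (G : Graph α β) (k : ℕ) : Prop :=
  V(G).Nontrivial ∧
    ∀ F : Set β, F ⊆ E(G) → F.encard < (k : ℕ∞) → (G.deleteEdges F).IsConnected

/-- A matching: a set of edges, none of which is a loop, no two of which share an end. -/
def IsEdgeMatching {α β : Type*} (G : Graph α β) (M : Set β) : Prop :=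
  M ⊆ E(G) ∧
    (∀ e ∈ M, ∀ x, ¬ G.IsLoopAt e x) ∧
    ∀ e ∈ M, ∀ f ∈ M, ∀ x, G.Inc e x → G.Inc f x → e = f

/-- A separating matching: a matching whose removal increases the number of
connected components. -/
def IsSeparatingMatching {α β : Type*} (G : Graph α β) (M : Set β) : Prop :=
  G.IsEdgeMatching M ∧ G.components.encard < (G.deleteEdges M).components.encard

/-- A multigraph is decomposable if it has a separating matching. -/
def IsDecomposable {α β : Type*} (G : Graph α β) : Prop :=
  ∃ M : Set β, G.IsSeparatingMatching M

/-- Isomorphism of multigraphs: bijections between the vertices and between the edges that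
preserve the ends of edges. -/
def IsIsomorphic {α β α' β' : Type*} (G : Graph α β) (H : Graph α' β') : Prop :=
  ∃ (φ : V(G) ≃ V(H)) (ψ : E(G) ≃ E(H)),
    ∀ (e : E(G)) (x y : V(G)), G.IsLink e x y ↔ H.IsLink (ψ e) (φ x) (φ y)

/-- `S₂`: two vertices joined by three parallel edges. -/
def S2 : Graph (Fin 2) (Fin 3) :=
  Graph.banana 0 1 Set.univ

/-- The complete graph on four vertices. -/
def K4 : Graph (Fin 4) (Sym2 (Fin 4)) :=
  Graph.ofSimpleGraph (⊤ : SimpleGraph (Fin 4))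

/-- The complete bipartite graph with three vertices in each class. -/
def K33 : Graph (Fin 3 ⊕ Fin 3) (Sym2 (Fin 3 ⊕ Fin 3)) :=
  Graph.ofSimpleGraph (completeBipartiteGraph (Fin 3) (Fin 3))

end Graph

/-!
For a set `A` of vertices of a cubic graph, moving a vertex `w` into or out of `A` changes the
number of boundary edges of `A` by `3 - 2k`, where `k` is the number of boundary edges at `w`. If
the boundary is not a matching, then `k ≥ 2` for some `w`, and moving `w` to the other side
shrinks the boundary. Starting from at most `n + 2` boundary edges with more than `n` vertices on
each side, this process must reach a separating matching, since the boundary keeps at least two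
edges by `2`-edge-connectivity.

By counting degrees, `A` contains a cycle as soon as it has at most `|A|` boundary edges. So if
`A` is the vertex set of a shortest cycle, of length `n > 2`, its nonempty proper subsets have
more boundary edges than elements, which forces each vertex of `A` to lie on exactly one boundary
edge. If `n ≥ 5`, the boundary of `A` is a matching: a vertex with two neighbours on the cycle
could replace both ends of an edge of the cycle that avoids these neighbours, creating a shorter
cycle. If `n ≤ 4` and there is no separating matching, moving vertices as above leaves at most
`n - 2` vertices outside `A`, and counting degrees there gives `2n - 2` vertices in total. For
`n = 2, 3, 4` this leaves only `S₂`, `K₄` and, the graph being triangle-free, `K₃,₃`.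
-/

namespace CubicGraph

open Graph Set

section EdgeBoundary

variable {α β : Type*} {H : Graph α β} {A B : Set α} {e : β} {x y : α}

/-- The edge boundary `δ(A)` of a vertex set: the edges with exactly one end in `A`. -/
def edgeBoundary (H : Graph α β) (A : Set α) : Set β :=
  {e | ∃ x ∈ A, ∃ y ∉ A, H.IsLink e x y}

lemma edgeBoundary_subset_edgeSet : edgeBoundary H A ⊆ E(H) :=
  fun _ ⟨_, _, _, _, h⟩ ↦ h.edge_mem

lemma mem_edgeBoundary_iff_of_isLink (h : H.IsLink e x y) :
    e ∈ edgeBoundary H A ↔ (x ∈ A ↔ y ∉ A) := by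
  constructor
  · rintro ⟨u, hu, v, hv, huv⟩
    obtain ⟨rfl, rfl⟩ | ⟨rfl, rfl⟩ := h.eq_and_eq_or_eq_and_eq huv <;> tauto
  · intro hxy
    by_cases hx : x ∈ A
    · exact ⟨x, hx, y, hxy.1 hx, h⟩
    · exact ⟨y, by tauto, x, hx, h.symm⟩

lemma mem_edgeBoundary_of_subset (hBA : B ⊆ A) (hx : x ∈ B) (hex : H.Inc e x)
    (he : e ∈ edgeBoundary H A) : e ∈ edgeBoundary H B := by
  obtain ⟨y, hxy⟩ := hex
  have hy : y ∉ A := ((mem_edgeBoundary_iff_of_isLink hxy).1 he).1 (hBA hx)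
  exact ⟨x, hx, y, fun h ↦ hy (hBA h), hxy⟩

lemma edgeBoundary_compl (H : Graph α β) (A : Set α) : edgeBoundary H Aᶜ = edgeBoundary H A := by
  ext e
  exact ⟨fun ⟨x, hx, y, hy, h⟩ ↦ ⟨y, not_not.1 hy, x, hx, h.symm⟩,
    fun ⟨x, hx, y, hy, h⟩ ↦ ⟨y, hy, x, not_not.2 hx, h.symm⟩⟩

lemma edgeBoundary_vertexSet_sdiff (H : Graph α β) (A : Set α) :
    edgeBoundary H (V(H) \ A) = edgeBoundary H A := by
  ext e
  exact ⟨fun ⟨x, hx, y, hy, h⟩ ↦ ⟨y, by_contra fun hyA ↦ hy ⟨h.right_mem, hyA⟩, x, hx.2, h.symm⟩,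
    fun ⟨x, hx, y, hy, h⟩ ↦ ⟨y, ⟨h.right_mem, hy⟩, x, fun hxA ↦ hxA.2 hx, h.symm⟩⟩

lemma edgeBoundary_empty (H : Graph α β) : edgeBoundary H ∅ = ∅ :=
  eq_empty_of_forall_notMem fun _ ⟨_, hx, _⟩ ↦ hx

lemma edgeBoundary_eq_empty_of_vertexSet_subset (h : V(H) ⊆ A) : edgeBoundary H A = ∅ :=
  eq_empty_of_forall_notMem fun _ ⟨_, _, _, hy, hxy⟩ ↦ hy (h hxy.right_mem)

lemma mem_of_reachable_deleteEdges_edgeBoundary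
    (h : (H.deleteEdges (edgeBoundary H A)).Reachable x y) (hx : x ∈ A) : y ∈ A := by
  induction h with
  | refl => exact hx
  | tail _ hadj hy =>
    obtain ⟨e, he⟩ := hadj
    rw [deleteEdges_isLink] at he
    by_contra hz
    exact he.2 ⟨_, hy, _, hz, he.1⟩

lemma le_ncard_edgeBoundary {k : ℕ} (hk : H.IsEdgeConnected k) (hA : (V(H) ∩ A).Nonempty)
    (hA' : (V(H) \ A).Nonempty) (hfin : (edgeBoundary H A).Finite) :
    k ≤ (edgeBoundary H A).ncard := by
  obtain ⟨x, hxV, hxA⟩ := hA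
  obtain ⟨y, hyV, hyA⟩ := hA'
  by_contra! hlt
  rw [← Nat.cast_lt (α := ℕ∞), hfin.cast_ncard_eq] at hlt
  exact hyA (mem_of_reachable_deleteEdges_edgeBoundary
    ((hk.2 _ edgeBoundary_subset_edgeSet hlt).2 x hxV y hyV) hxA)

lemma isConnected_of_isEdgeConnected {k : ℕ} (hk : H.IsEdgeConnected k) (hpos : 0 < k) :
    H.IsConnected := by
  have h := hk.2 ∅ (empty_subset _) (by simpa using hpos)
  rwa [deleteEdges_empty] at h

lemma encard_components_le_one (h : H.IsConnected) : H.components.encard ≤ 1 := by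
  have hcomp : ∀ x ∈ V(H), {y | H.Reachable x y} = V(H) := by
    refine fun x hx ↦ Subset.antisymm (fun y hy ↦ ?_) (h.2 x hx)
    obtain rfl | ⟨_, _, hadj⟩ := Relation.ReflTransGen.cases_tail hy
    exacts [hx, hadj.right_mem]
  rw [encard_le_one_iff]
  rintro _ _ ⟨x, hx, rfl⟩ ⟨y, hy, rfl⟩
  rw [hcomp x hx, hcomp y hy]

lemma isDecomposable_of_subsingleton_inter_edgeBoundary (h : H.IsConnected)
    (hA : (V(H) ∩ A).Nonempty) (hA' : (V(H) \ A).Nonempty)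
    (hmatch : ∀ w ∈ V(H), (H.incidenceSet w ∩ edgeBoundary H A).Subsingleton) :
    H.IsDecomposable := by
  obtain ⟨x, hxV, hxA⟩ := hA
  obtain ⟨y, hyV, hyA⟩ := hA'
  refine ⟨edgeBoundary H A, ⟨edgeBoundary_subset_edgeSet, ?_, ?_⟩,
    (encard_components_le_one h).trans_lt ?_⟩
  · intro e he x hloop
    have := (mem_edgeBoundary_iff_of_isLink hloop).1 he
    tauto
  · exact fun e he f hf w hew hfw ↦ hmatch w hew.vertex_mem ⟨hew, he⟩ ⟨hfw, hf⟩
  · refine one_lt_encard_iff.2 ⟨_, _, ⟨x, hxV, rfl⟩, ⟨y, hyV, rfl⟩, fun heq ↦ hyA ?_⟩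
    exact mem_of_reachable_deleteEdges_edgeBoundary
      ((Set.ext_iff.1 heq y).2 Relation.ReflTransGen.refl) hxA

end EdgeBoundary

section Counting

variable {α β : Type*} {H : Graph α β} {A : Set α} {x w : α}

lemma edgeBoundary_singleton (H : Graph α β) (x : α) :
    edgeBoundary H {x} = H.incidenceSet x \ H.loopSet x := by
  ext e
  constructor
  · rintro ⟨_, rfl, y, hy, h⟩
    exact ⟨h.inc_left, fun hloop ↦ hy (h.right_unique hloop)⟩
  · rintro ⟨⟨y, h⟩, hloop⟩
    exact ⟨x, rfl, y, fun hy ↦ hloop (hy ▸ h), h⟩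

lemma finite_incidenceSet (hc : H.IsCubic) (x : α) : (H.incidenceSet x).Finite := by
  by_cases hx : x ∈ V(H)
  · exact finite_of_encard_le_coe (k := 3) (le_self_add.trans (hc x hx).le)
  · have hempty : H.incidenceSet x = ∅ := eq_empty_of_forall_notMem fun _ he ↦ hx he.vertex_mem
    exact hempty ▸ finite_empty

lemma ncard_incidenceSet_add_ncard_loopSet (hc : H.IsCubic) (hx : x ∈ V(H)) :
    (H.incidenceSet x).ncard + (H.loopSet x).ncard = 3 := by
  have hinc := finite_incidenceSet hc x
  have hdeg := hc x hx
  rw [edegree, ← hinc.cast_ncard_eq,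
    ← (hinc.subset (H.loopSet_subset_incidenceSet x)).cast_ncard_eq] at hdeg
  exact_mod_cast hdeg

lemma loopless_of_isCubic_of_isEdgeConnected (hc : H.IsCubic) (hk : H.IsEdgeConnected 2) :
    H.Loopless := by
  refine ⟨fun e x hloop ↦ ?_⟩
  have hx : x ∈ V(H) := hloop.left_mem
  have hinc := finite_incidenceSet hc x
  have hloops := hinc.subset (H.loopSet_subset_incidenceSet x)
  obtain ⟨y, hy, hyx⟩ := hk.1.exists_ne x
  have hcut : 2 ≤ (H.incidenceSet x \ H.loopSet x).ncard := by
    rw [← edgeBoundary_singleton]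
    refine le_ncard_edgeBoundary hk ⟨x, hx, rfl⟩ ⟨y, hy, hyx⟩ ?_
    exact edgeBoundary_singleton H x ▸ hinc.sdiff
  have hsplit := ncard_sdiff_add_ncard_of_subset (H.loopSet_subset_incidenceSet x) hinc
  have hdeg := ncard_incidenceSet_add_ncard_loopSet hc hx
  have hpos := (ncard_pos hloops).2 ⟨e, hloop⟩
  omega

lemma finite_edgeBoundary (hc : H.IsCubic) (hA : A.Finite) : (edgeBoundary H A).Finite :=
  (hA.biUnion fun x _ ↦ finite_incidenceSet hc x).subset
    fun _ ⟨_, hx, _, _, h⟩ ↦ mem_biUnion hx h.inc_left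

lemma finite_edgeSet_induce (hc : H.IsCubic) (hA : A.Finite) : E(H.induce A).Finite :=
  (hA.biUnion fun x _ ↦ finite_incidenceSet hc x).subset
    fun _ ⟨_, _, h, hx, _⟩ ↦ mem_biUnion hx h.inc_left

lemma disjoint_edgeSet_induce_edgeBoundary : Disjoint E(H.induce A) (edgeBoundary H A) :=
  disjoint_left.2 fun _ ⟨_, _, h, hx, hy⟩ he ↦ ((mem_edgeBoundary_iff_of_isLink h).1 he).1 hx hy

variable [H.Loopless]

lemma ncard_incidenceSet (hc : H.IsCubic) (hx : x ∈ V(H)) : (H.incidenceSet x).ncard = 3 := by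
  have hloop : H.loopSet x = ∅ := eq_empty_of_forall_notMem fun e ↦ H.not_isLoopAt e x
  simpa only [hloop, ncard_empty, add_zero] using ncard_incidenceSet_add_ncard_loopSet hc hx

lemma edgeBoundary_insert (hwA : w ∉ A) :
    edgeBoundary H (insert w A) =
      edgeBoundary H A \ H.incidenceSet w ∪ H.incidenceSet w \ edgeBoundary H A := by
  ext e
  by_cases he : e ∈ E(H)
  · obtain ⟨x, y, h⟩ := exists_isLink_of_mem_edgeSet he
    have hinc : H.Inc e w ↔ w = x ∨ w = y :=
      ⟨fun hw ↦ hw.eq_or_eq_of_isLink h, by rintro (rfl | rfl); exacts [h.inc_left, h.inc_right]⟩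
    have hxy := h.ne
    simp only [mem_union, mem_sdiff, mem_edgeBoundary_iff_of_isLink h, mem_insert_iff,
      mem_incidenceSet, hinc]
    grind
  · exact iff_of_false (fun h ↦ he (edgeBoundary_subset_edgeSet h))
      (by rintro (h | h); exacts [he (edgeBoundary_subset_edgeSet h.1), he h.1.edge_mem])

lemma finite_edgeBoundary_insert (hc : H.IsCubic) (hwA : w ∉ A)
    (hfin : (edgeBoundary H A).Finite) : (edgeBoundary H (insert w A)).Finite :=
  (edgeBoundary_insert (H := H) hwA) ▸ hfin.sdiff.union (finite_incidenceSet hc w).sdiff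

lemma ncard_edgeBoundary_insert (hc : H.IsCubic) (hw : w ∈ V(H)) (hwA : w ∉ A)
    (hfin : (edgeBoundary H A).Finite) :
    (edgeBoundary H (insert w A)).ncard + 2 * (H.incidenceSet w ∩ edgeBoundary H A).ncard =
      (edgeBoundary H A).ncard + 3 := by
  have hinc := finite_incidenceSet hc w
  have hsplit := ncard_inter_add_ncard_sdiff_eq_ncard (H.incidenceSet w) (edgeBoundary H A) hinc
  have hsplit' := ncard_inter_add_ncard_sdiff_eq_ncard (edgeBoundary H A) (H.incidenceSet w) hfin
  have hunion := ncard_union_eq (disjoint_sdiff_left.mono_right sdiff_subset)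
    (hfin.sdiff (t := H.incidenceSet w)) (hinc.sdiff (t := edgeBoundary H A))
  rw [← edgeBoundary_insert hwA] at hunion
  rw [inter_comm] at hsplit'
  have hdeg := ncard_incidenceSet hc hw
  omega

lemma ncard_edgeBoundary_sdiff_singleton (hc : H.IsCubic) (hx : x ∈ V(H)) (hxA : x ∈ A)
    (hfin : (edgeBoundary H A).Finite) :
    (edgeBoundary H (A \ {x})).ncard + 2 * (H.incidenceSet x ∩ edgeBoundary H A).ncard =
      (edgeBoundary H A).ncard + 3 := by
  rw [← edgeBoundary_compl H A] at hfin ⊢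
  rw [← edgeBoundary_compl H (A \ {x}), compl_sdiff, singleton_union]
  exact ncard_edgeBoundary_insert hc hx (not_not.2 hxA) hfin

lemma edgeSet_induce_insert (hwA : w ∉ A) :
    E(H.induce (insert w A)) = E(H.induce A) ∪ H.incidenceSet w ∩ edgeBoundary H A := by
  ext e
  constructor
  · rintro ⟨x, y, h, rfl | hx, rfl | hy⟩
    · exact (H.not_isLoopAt _ _ h).elim
    · exact .inr ⟨h.inc_left, y, hy, x, hwA, h.symm⟩
    · exact .inr ⟨h.inc_right, x, hx, y, hwA, h⟩
    · exact .inl ⟨x, y, h, hx, hy⟩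
  · rintro (⟨x, y, h, hx, hy⟩ | ⟨hw, x, hx, y, hy, h⟩)
    · exact ⟨x, y, h, .inr hx, .inr hy⟩
    · obtain rfl : w = y := (hw.eq_or_eq_of_isLink h).resolve_left fun h ↦ hwA (h ▸ hx)
      exact ⟨x, w, h, .inr hx, .inl rfl⟩

/-- The degrees of the vertices of `A` count the boundary edges once and the inner edges twice. -/
lemma ncard_edgeBoundary_add_two_mul_ncard_edgeSet_induce (hc : H.IsCubic) (hfin : A.Finite)
    (hA : A ⊆ V(H)) :
    (edgeBoundary H A).ncard + 2 * E(H.induce A).ncard = 3 * A.ncard := by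
  induction A, hfin using Set.Finite.induction_on with
  | empty => simp [edgeBoundary_empty, edgeSet_induce]
  | @insert w A hwA hfin ih =>
    obtain ⟨hw, hA⟩ := insert_subset_iff.1 hA
    have hδ := ncard_edgeBoundary_insert hc hw hwA (finite_edgeBoundary hc hfin)
    have hE := ncard_union_eq (disjoint_edgeSet_induce_edgeBoundary.mono_right inter_subset_right)
      (finite_edgeSet_induce hc hfin)
      ((finite_incidenceSet hc w).inter_of_left (edgeBoundary H A))
    rw [← edgeSet_induce_insert hwA] at hE
    have hA' := ncard_insert_of_notMem hwA hfin
    have := ih hA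
    omega

end Counting

section SmallCuts

variable {α β : Type*} {H : Graph α β} {A : Set α} {w : α}

lemma exists_nontrivial_inter_edgeBoundary (h : H.IsConnected) (hnd : ¬ H.IsDecomposable)
    (hA : (V(H) ∩ A).Nonempty) (hA' : (V(H) \ A).Nonempty) :
    ∃ w ∈ V(H), (H.incidenceSet w ∩ edgeBoundary H A).Nontrivial := by
  by_contra! hmatch
  exact hnd (isDecomposable_of_subsingleton_inter_edgeBoundary h hA hA' hmatch)

lemma one_lt_ncard_edgeBoundary_insert (hc : H.IsCubic) (hk : H.IsEdgeConnected 2)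
    (hw : w ∈ V(H)) (hwA : w ∉ A) (hfin : (edgeBoundary H A).Finite)
    (hδ : (edgeBoundary H A).ncard ≤ 2) : 1 < (edgeBoundary H (insert w A)).ncard := by
  have := loopless_of_isCubic_of_isEdgeConnected hc hk
  by_cases hout : (V(H) \ insert w A).Nonempty
  · exact le_ncard_edgeBoundary hk ⟨w, hw, mem_insert w A⟩ hout
      (finite_edgeBoundary_insert hc hwA hfin)
  · rw [not_nonempty_iff_eq_empty, sdiff_eq_empty] at hout
    have hshift := ncard_edgeBoundary_insert hc hw hwA hfin
    have hinter := ncard_le_ncard (inter_subset_right (s := H.incidenceSet w)) hfin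
    rw [edgeBoundary_eq_empty_of_vertexSet_subset hout, ncard_empty] at hshift
    omega

/-- As long as a cut is not a matching, some vertex has two boundary edges, and moving it to the
other side shrinks the cut. -/
lemma isDecomposable_of_ncard_edgeBoundary_le (hc : H.IsCubic) (hk : H.IsEdgeConnected 2) {n : ℕ}
    (hfin : (edgeBoundary H A).Finite) (hδ : (edgeBoundary H A).ncard ≤ n + 2)
    (hA : n < (V(H) ∩ A).encard) (hA' : n < (V(H) \ A).encard) : H.IsDecomposable := by
  have := loopless_of_isCubic_of_isEdgeConnected hc hk
  by_contra hnd
  induction n using Nat.strong_induction_on generalizing A with | _ n ih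
  obtain ⟨w, hw, hcross⟩ := exists_nontrivial_inter_edgeBoundary
    (isConnected_of_isEdgeConnected hk two_pos) hnd (nonempty_of_encard_ne_zero hA.ne_bot)
    (nonempty_of_encard_ne_zero hA'.ne_bot)
  wlog hwA : w ∉ A generalizing A
  · rw [← edgeBoundary_compl H A] at hfin hδ hcross
    exact this hfin hδ (by rwa [← sdiff_eq]) (by rwa [sdiff_compl]) hcross (by simpa using hwA)
  have hshift := ncard_edgeBoundary_insert hc hw hwA hfin
  have hcross' := one_lt_ncard_iff_nontrivial_and_finite.2 ⟨hcross, hfin.inter_of_right _⟩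
  obtain _ | m := n
  · have := one_lt_ncard_edgeBoundary_insert hc hk hw hwA hfin hδ
    omega
  · refine ih m m.lt_succ_self (finite_edgeBoundary_insert hc hwA hfin) (by omega) ?_ ?_
    · have hle := encard_le_encard (inter_subset_inter_right V(H) (subset_insert w A))
      exact (Nat.cast_lt.2 m.lt_succ_self).trans (hA.trans_le hle)
    · have hsub : V(H) \ A ⊆ insert w (V(H) \ insert w A) := by grind
      have hle := (encard_le_encard hsub).trans (encard_insert_le _ _)
      exact lt_of_add_lt_add_right (a := 1) (by exact_mod_cast hA'.trans_le hle)

end SmallCuts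

section ShortestCycle

variable {α β : Type*} {H : Graph α β} {A : Set α} {e f : β} {x y : α}

/-- `A` is a finite nonempty set of vertices spanning at least as many edges as it has elements.
The vertex set of a cycle has this property, and conversely any set with this property contains
the vertex set of a cycle. -/
structure SpansCycle (H : Graph α β) (A : Set α) : Prop where
  subset : A ⊆ V(H)
  finite : A.Finite
  nonempty : A.Nonempty
  encard_le : A.encard ≤ E(H.induce A).encard

/-- `A` is the vertex set of a shortest cycle, expressed as minimality of its cardinality among
the sets that span a cycle. -/
def IsShortestCycle (H : Graph α β) (A : Set α) : Prop :=
  MinimalFor (SpansCycle H) ncard A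

lemma exists_encard_le_encard_edgeSet_induce_add_one (hx : x ∈ V(H)) (h : H.Reachable x y) :
    ∃ A ⊆ V(H), A.Finite ∧ x ∈ A ∧ y ∈ A ∧ A.encard ≤ E(H.induce A).encard + 1 := by
  induction h with
  | refl => exact ⟨{x}, by simpa, finite_singleton x, rfl, rfl, by simp⟩
  | @tail y z _ hadj ih =>
    obtain ⟨A, hA, hfin, hxA, hyA, hcard⟩ := ih
    by_cases hz : z ∈ A
    · exact ⟨A, hA, hfin, hxA, hz, hcard⟩
    obtain ⟨e, he⟩ := hadj
    refine ⟨insert z A, insert_subset he.right_mem hA, hfin.insert z, .inr hxA, .inl rfl, ?_⟩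
    have hnew : e ∉ E(H.induce A) := fun ⟨u, v, huv, hu, hv⟩ ↦
      hz <| (he.right_eq_or_eq huv).elim (· ▸ hu) (· ▸ hv)
    have hsub : insert e E(H.induce A) ⊆ E(H.induce (insert z A)) :=
      insert_subset ⟨y, z, he, .inr hyA, .inl rfl⟩
        fun _ ⟨u, v, huv, hu, hv⟩ ↦ ⟨u, v, huv, .inr hu, .inr hv⟩
    rw [encard_insert_of_notMem hz]
    gcongr
    exact hcard.trans ((encard_insert_of_notMem hnew).symm.trans_le (encard_le_encard hsub))

lemma exists_spansCycle (hk : H.IsEdgeConnected 2) (he : H.IsLink e x y) :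
    ∃ A, SpansCycle H A := by
  have hreach : (H.deleteEdges {e}).Reachable x y :=
    (hk.2 {e} (by simpa using he.edge_mem) (by simp)).2 x he.left_mem y he.right_mem
  obtain ⟨A, hA, hfin, hx, hy, hcard⟩ :=
    exists_encard_le_encard_edgeSet_induce_add_one (H := H.deleteEdges {e}) he.left_mem hreach
  refine ⟨A, hA, hfin, ⟨x, hx⟩, hcard.trans ?_⟩
  have hnew : e ∉ E((H.deleteEdges {e}).induce A) := fun ⟨_, _, h, _⟩ ↦ by simp at h
  rw [← encard_insert_of_notMem hnew]
  exact encard_le_encard <| insert_subset ⟨x, y, he, hx, hy⟩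
    fun _ ⟨u, v, huv, hu, hv⟩ ↦ ⟨u, v, IsLink.mono deleteEdges_le huv, hu, hv⟩

lemma exists_isShortestCycle (hc : H.IsCubic) (hk : H.IsEdgeConnected 2) :
    ∃ A, IsShortestCycle H A := by
  have := loopless_of_isCubic_of_isEdgeConnected hc hk
  obtain ⟨x, hx⟩ := hk.1.nonempty
  obtain ⟨e, y, he⟩ : (H.incidenceSet x).Nonempty :=
    nonempty_of_ncard_ne_zero (by rw [ncard_incidenceSet hc hx]; simp)
  exact exists_minimalFor_of_wellFoundedLT _ _ (exists_spansCycle hk he)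

variable [H.Loopless]

lemma SpansCycle.one_lt_ncard (h : SpansCycle H A) : 1 < A.ncard := by
  have hpos : 0 < E(H.induce A).encard := (encard_pos.2 h.nonempty).trans_le h.encard_le
  obtain ⟨e, x, y, he, hx, hy⟩ := encard_pos.1 hpos
  exact (Set.one_lt_ncard h.finite).2 ⟨x, hx, y, hy, he.ne⟩

lemma spansCycle_iff_ncard_edgeBoundary_le (hc : H.IsCubic) (hA : A ⊆ V(H)) (hfin : A.Finite)
    (hne : A.Nonempty) : SpansCycle H A ↔ (edgeBoundary H A).ncard ≤ A.ncard := by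
  have hsum := ncard_edgeBoundary_add_two_mul_ncard_edgeSet_induce hc hfin hA
  have hE := finite_edgeSet_induce hc hfin
  have hiff : A.encard ≤ E(H.induce A).encard ↔ A.ncard ≤ E(H.induce A).ncard := by
    rw [← hfin.cast_ncard_eq, ← hE.cast_ncard_eq, Nat.cast_le]
  exact ⟨fun h ↦ by have := hiff.1 h.encard_le; omega,
    fun h ↦ ⟨hA, hfin, hne, hiff.2 (by omega)⟩⟩

lemma spansCycle_pair (he : H.IsLink e x y) (hf : H.IsLink f x y) (hef : e ≠ f) :
    SpansCycle H {x, y} where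
  subset := pair_subset he.left_mem he.right_mem
  finite := toFinite _
  nonempty := insert_nonempty x {y}
  encard_le := by
    rw [encard_pair he.ne, ← encard_pair hef]
    refine encard_le_encard (pair_subset ?_ ?_)
    exacts [⟨x, y, he, by simp⟩, ⟨x, y, hf, by simp⟩]

end ShortestCycle

namespace IsShortestCycle

variable {α β : Type*} {H : Graph α β} {A B : Set α} {e f : β} {u v x y w : α}

lemma subset (h : IsShortestCycle H A) : A ⊆ V(H) := h.prop.subset

lemma finite (h : IsShortestCycle H A) : A.Finite := h.prop.finite

lemma ncard_le (h : IsShortestCycle H A) (hB : SpansCycle H B) : A.ncard ≤ B.ncard :=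
  (le_total _ _).elim id fun hle ↦ h.le_of_le hB hle

variable [H.Loopless]

lemma simple (h : IsShortestCycle H A) (hcard : 2 < A.ncard) : H.Simple where
  eq_of_isLink e f x y he hf := by
    by_contra hef
    have hle := h.ncard_le (spansCycle_pair he hf hef)
    rw [ncard_pair he.ne] at hle
    omega

lemma ncard_edgeBoundary_le (hc : H.IsCubic) (h : IsShortestCycle H A) :
    (edgeBoundary H A).ncard ≤ A.ncard :=
  (spansCycle_iff_ncard_edgeBoundary_le hc h.subset h.finite h.prop.nonempty).1 h.prop

lemma ncard_lt_ncard_edgeBoundary (hc : H.IsCubic) (h : IsShortestCycle H A) (hB : B ⊆ V(H))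
    (hne : B.Nonempty) (hfin : B.Finite) (hlt : B.ncard < A.ncard) :
    B.ncard < (edgeBoundary H B).ncard := by
  by_contra! hle
  exact hlt.not_ge (h.ncard_le ((spansCycle_iff_ncard_edgeBoundary_le hc hB hfin hne).2 hle))

lemma ncard_le_ncard_edgeBoundary_sdiff_singleton (hc : H.IsCubic) (h : IsShortestCycle H A)
    (hx : x ∈ A) : A.ncard ≤ (edgeBoundary H (A \ {x})).ncard := by
  have hcard := ncard_sdiff_singleton_add_one hx h.finite
  have hne : (A \ {x}).Nonempty :=
    nonempty_of_ncard_ne_zero (by have := h.prop.one_lt_ncard; omega)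
  have hlt := h.ncard_lt_ncard_edgeBoundary hc (sdiff_subset.trans h.subset) hne
    h.finite.sdiff (by omega)
  omega

lemma ncard_incidenceSet_inter_edgeBoundary_le_one (hc : H.IsCubic) (h : IsShortestCycle H A)
    (hx : x ∈ A) : (H.incidenceSet x ∩ edgeBoundary H A).ncard ≤ 1 := by
  have hle := h.ncard_edgeBoundary_le hc
  have hge := h.ncard_le_ncard_edgeBoundary_sdiff_singleton hc hx
  have hshift := ncard_edgeBoundary_sdiff_singleton hc (h.subset hx) hx
    (finite_edgeBoundary hc h.finite)
  omega

lemma eq_of_inc_of_mem_edgeBoundary (hc : H.IsCubic) (h : IsShortestCycle H A) (hx : x ∈ A)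
    (hex : H.Inc e x) (he : e ∈ edgeBoundary H A) (hfx : H.Inc f x)
    (hf : f ∈ edgeBoundary H A) : e = f :=
  (ncard_le_one ((finite_incidenceSet hc x).inter_of_left _)).1
    (h.ncard_incidenceSet_inter_edgeBoundary_le_one hc hx) e ⟨hex, he⟩ f ⟨hfx, hf⟩

lemma ncard_edgeBoundary (hc : H.IsCubic) (h : IsShortestCycle H A) (hcard : 2 < A.ncard) :
    (edgeBoundary H A).ncard = A.ncard := by
  by_contra hne
  have hle := h.ncard_edgeBoundary_le hc
  have hfin := finite_edgeBoundary hc h.finite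
  have hsum := ncard_edgeBoundary_add_two_mul_ncard_edgeSet_induce hc h.finite h.subset
  have hshift : ∀ x ∈ A, (H.incidenceSet x ∩ edgeBoundary H A).ncard = 0 ∧
      A.ncard ≤ (edgeBoundary H A).ncard + 3 := fun x hx ↦ by
    have hge := h.ncard_le_ncard_edgeBoundary_sdiff_singleton hc hx
    have := ncard_edgeBoundary_sdiff_singleton hc (h.subset hx) hx hfin
    omega
  have hempty : edgeBoundary H A = ∅ := by
    refine eq_empty_of_forall_notMem fun e he ↦ ?_
    have ⟨x, hx, y, _, hxy⟩ := he
    have hmem : e ∈ H.incidenceSet x ∩ edgeBoundary H A := ⟨hxy.inc_left, he⟩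
    exact ncard_ne_zero_of_mem hmem (hfin.inter_of_right _) (hshift x hx).1
  obtain ⟨x, hx⟩ := h.prop.nonempty
  have hge := (hshift x hx).2
  rw [hempty, ncard_empty] at hsum hge
  omega

lemma exists_mem_edgeBoundary_inc (hc : H.IsCubic) (h : IsShortestCycle H A)
    (hcard : 2 < A.ncard) (hx : x ∈ A) : ∃ e ∈ edgeBoundary H A, H.Inc e x := by
  by_contra! hnone
  have hinner : ∀ e ∈ edgeBoundary H A, ∃ u ∈ A, H.Inc e u :=
    fun e ⟨u, hu, _, _, huv⟩ ↦ ⟨u, hu, huv.inc_left⟩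
  have : Nonempty α := ⟨x⟩
  choose! i hiA hi using hinner
  have hlt : (A \ {x}).ncard < (edgeBoundary H A).ncard := by
    rw [h.ncard_edgeBoundary hc hcard]
    exact ncard_sdiff_singleton_lt_of_mem hx h.finite
  obtain ⟨e, he, f, hf, hef, hieq⟩ := exists_ne_map_eq_of_ncard_lt_of_maps_to hlt
    (fun e he ↦ ⟨hiA e he, fun heq ↦ hnone e he (heq ▸ hi e he)⟩) h.finite.sdiff
  exact hef (h.eq_of_inc_of_mem_edgeBoundary hc (hiA e he) (hi e he) he (hieq ▸ hi f hf) hf)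

lemma nonempty_vertexSet_sdiff (hc : H.IsCubic) (h : IsShortestCycle H A)
    (hcard : 2 < A.ncard) : (V(H) \ A).Nonempty := by
  obtain ⟨x, hx⟩ := h.prop.nonempty
  obtain ⟨_, ⟨_, _, y, hy, hxy⟩, _⟩ := h.exists_mem_edgeBoundary_inc hc hcard hx
  exact ⟨y, hxy.right_mem, hy⟩

lemma ncard_edgeBoundary_sdiff_singleton (hc : H.IsCubic) (h : IsShortestCycle H A)
    (hcard : 2 < A.ncard) (hx : x ∈ A) : (edgeBoundary H (A \ {x})).ncard = A.ncard + 1 := by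
  have hfin := finite_edgeBoundary hc h.finite
  have hshift := CubicGraph.ncard_edgeBoundary_sdiff_singleton hc (h.subset hx) hx hfin
  have hδ := h.ncard_edgeBoundary hc hcard
  obtain ⟨d, hd, hdx⟩ := h.exists_mem_edgeBoundary_inc hc hcard hx
  have hpos := (ncard_pos (hfin.inter_of_right (H.incidenceSet x))).2 ⟨d, hdx, hd⟩
  have hle := h.ncard_incidenceSet_inter_edgeBoundary_le_one hc hx
  omega

lemma nonempty_edgeSet_induce_sdiff_pair (hc : H.IsCubic) (h : IsShortestCycle H A)
    (hcard : 4 < A.ncard) (hu : u ∈ A) (hv : v ∈ A) (huv : u ≠ v) :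
    E(H.induce ((A \ {u}) \ {v})).Nonempty := by
  have hv' : v ∈ A \ {u} := ⟨hv, huv.symm⟩
  have hfin : (A \ {u}).Finite := h.finite.sdiff
  have hfin' := finite_edgeBoundary hc hfin
  have hδ := h.ncard_edgeBoundary_sdiff_singleton hc (by omega) hu
  have hδ' := CubicGraph.ncard_edgeBoundary_sdiff_singleton hc (h.subset hv) hv' hfin'
  obtain ⟨d, hd, hdv⟩ := h.exists_mem_edgeBoundary_inc hc (by omega) hv
  have hpos := (ncard_pos (hfin'.inter_of_right (H.incidenceSet v))).2
    ⟨d, hdv, mem_edgeBoundary_of_subset sdiff_subset hv' hdv hd⟩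
  have hB := ncard_sdiff_singleton_add_one hu h.finite
  have hB' := ncard_sdiff_singleton_add_one hv' hfin
  have hsum := ncard_edgeBoundary_add_two_mul_ncard_edgeSet_induce hc (hfin.sdiff (t := {v}))
    (sdiff_subset.trans (sdiff_subset.trans h.subset))
  exact nonempty_of_ncard_ne_zero (by omega)

lemma ncard_edgeBoundary_sdiff_ends_le (hc : H.IsCubic) (h : IsShortestCycle H A)
    (hcard : 2 < A.ncard) (hx : x ∈ A) (hy : y ∈ A) (he : H.IsLink e x y) :
    (edgeBoundary H ((A \ {x}) \ {y})).ncard ≤ A.ncard := by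
  have hy' : y ∈ A \ {x} := ⟨hy, he.ne.symm⟩
  have hfin := finite_edgeBoundary hc (h.finite.sdiff (t := {x}))
  have hδ := h.ncard_edgeBoundary_sdiff_singleton hc hcard hx
  have hδ' := CubicGraph.ncard_edgeBoundary_sdiff_singleton hc (h.subset hy) hy' hfin
  obtain ⟨d, hd, hdy⟩ := h.exists_mem_edgeBoundary_inc hc hcard hy
  have hde : d ≠ e := by
    rintro rfl
    exact ((mem_edgeBoundary_iff_of_isLink he).1 hd).1 hx hy
  have htwo := (Set.one_lt_ncard (hfin.inter_of_right (H.incidenceSet y))).2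
    ⟨d, ⟨hdy, mem_edgeBoundary_of_subset sdiff_subset hy' hdy hd⟩,
      e, ⟨he.inc_right, y, hy', x, fun hx' ↦ hx'.2 rfl, he.symm⟩, hde⟩
  omega

/-- Otherwise `w` could replace `x` and `y` to give a shorter cycle. -/
lemma ncard_incidenceSet_inter_edgeBoundary_sdiff_ends_le_one (hc : H.IsCubic)
    (h : IsShortestCycle H A) (hcard : 2 < A.ncard) (hx : x ∈ A) (hy : y ∈ A)
    (he : H.IsLink e x y) (hw : w ∈ V(H)) (hwA : w ∉ A) :
    (H.incidenceSet w ∩ edgeBoundary H ((A \ {x}) \ {y})).ncard ≤ 1 := by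
  have hy' : y ∈ A \ {x} := ⟨hy, he.ne.symm⟩
  have hδ := h.ncard_edgeBoundary_sdiff_ends_le hc hcard hx hy he
  have hBx := ncard_sdiff_singleton_add_one hx h.finite
  have hBy := ncard_sdiff_singleton_add_one hy' h.finite.sdiff
  have hBA : (A \ {x}) \ {y} ⊆ A := sdiff_subset.trans sdiff_subset
  generalize (A \ {x}) \ {y} = B at *
  have hfin : B.Finite := h.finite.subset hBA
  have hwB : w ∉ B := fun hw ↦ hwA (hBA hw)
  have hshift := ncard_edgeBoundary_insert hc hw hwB (finite_edgeBoundary hc hfin)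
  have hBw := ncard_insert_of_notMem hwB hfin
  have hlt := h.ncard_lt_ncard_edgeBoundary hc (insert_subset hw (hBA.trans h.subset))
    (insert_nonempty w B) (hfin.insert w) (by omega)
  omega

lemma subsingleton_inter_edgeBoundary (hc : H.IsCubic) (h : IsShortestCycle H A)
    (hcard : 4 < A.ncard) (hw : w ∈ V(H)) :
    (H.incidenceSet w ∩ edgeBoundary H A).Subsingleton := by
  have := h.simple (by omega)
  rintro e ⟨hew, he⟩ f ⟨hfw, hf⟩
  by_cases hwA : w ∈ A
  · exact h.eq_of_inc_of_mem_edgeBoundary hc hwA hew he hfw hf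
  by_contra hef
  obtain ⟨u, heu⟩ := id hew
  obtain ⟨v, hfv⟩ := id hfw
  have hu : u ∈ A := by simpa [hwA] using (mem_edgeBoundary_iff_of_isLink heu).1 he
  have hv : v ∈ A := by simpa [hwA] using (mem_edgeBoundary_iff_of_isLink hfv).1 hf
  have huv : u ≠ v := fun huv ↦ hef (heu.eq (huv ▸ hfv))
  obtain ⟨g, x, y, hg, hx, hy⟩ := h.nonempty_edgeSet_induce_sdiff_pair hc hcard hu hv huv
  have hle := h.ncard_incidenceSet_inter_edgeBoundary_sdiff_ends_le_one hc (by omega)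
    hx.1.1 hy.1.1 hg hw hwA
  have huB : u ∈ (A \ {x}) \ {y} := by grind
  have hvB : v ∈ (A \ {x}) \ {y} := by grind
  have hBA : (A \ {x}) \ {y} ⊆ A := sdiff_subset.trans sdiff_subset
  exact hef <| (ncard_le_one ((finite_incidenceSet hc w).inter_of_left _)).1 hle
    e ⟨hew, mem_edgeBoundary_of_subset hBA huB heu.inc_right he⟩
    f ⟨hfw, mem_edgeBoundary_of_subset hBA hvB hfv.inc_right hf⟩

lemma ncard_le_four (hc : H.IsCubic) (hk : H.IsEdgeConnected 2) (h : IsShortestCycle H A)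
    (hnd : ¬ H.IsDecomposable) : A.ncard ≤ 4 := by
  by_contra! hcard
  exact hnd <| isDecomposable_of_subsingleton_inter_edgeBoundary
    (isConnected_of_isEdgeConnected hk two_pos)
    (h.prop.nonempty.mono (subset_inter h.subset subset_rfl))
    (h.nonempty_vertexSet_sdiff hc (by omega))
    fun _ hw ↦ h.subsingleton_inter_edgeBoundary hc hcard hw

lemma ncard_vertexSet_sdiff_add_two_le (hc : H.IsCubic) (hk : H.IsEdgeConnected 2)
    (h : IsShortestCycle H A) (hnd : ¬ H.IsDecomposable) :
    (V(H) \ A).Finite ∧ (V(H) \ A).ncard + 2 ≤ A.ncard := by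
  have hcard := h.prop.one_lt_ncard
  have hle : (V(H) \ A).encard ≤ (A.ncard - 2 : ℕ) := by
    by_contra! hlt
    refine hnd (isDecomposable_of_ncard_edgeBoundary_le hc hk (finite_edgeBoundary hc h.finite)
      (n := A.ncard - 2) ((h.ncard_edgeBoundary_le hc).trans (by omega)) ?_ hlt)
    rw [inter_eq_self_of_subset_right h.subset, ← h.finite.cast_ncard_eq, Nat.cast_lt]
    omega
  have hfin := finite_of_encard_le_coe hle
  rw [← hfin.cast_ncard_eq, Nat.cast_le] at hle
  exact ⟨hfin, by omega⟩

lemma ncard_vertexSet_add_two (hc : H.IsCubic) (hk : H.IsEdgeConnected 2)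
    (h : IsShortestCycle H A) (hnd : ¬ H.IsDecomposable) : V(H).ncard + 2 = 2 * A.ncard := by
  obtain ⟨hfin, hle⟩ := h.ncard_vertexSet_sdiff_add_two_le hc hk hnd
  have hsplit := ncard_sdiff_add_ncard_of_subset h.subset
    (sdiff_union_of_subset h.subset ▸ hfin.union h.finite)
  have hfour := h.ncard_le_four hc hk hnd
  obtain htwo | htwo := Nat.eq_or_lt_of_le h.prop.one_lt_ncard
  · omega
  · have hδ := h.ncard_edgeBoundary hc htwo
    have hsum := ncard_edgeBoundary_add_two_mul_ncard_edgeSet_induce hc hfin sdiff_subset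
    rw [edgeBoundary_vertexSet_sdiff] at hsum
    omega

end IsShortestCycle

section RegularSimpleGraphs

variable {V : Type*} [Fintype V] {G : SimpleGraph V} [DecidableRel G.Adj] {d : ℕ}

lemma eq_top_of_isRegularOfDegree (hreg : G.IsRegularOfDegree d)
    (hcard : Fintype.card V = d + 1) : G = ⊤ :=
  SimpleGraph.eq_top_iff_forall_isUniversal.2 fun v ↦
    (G.degree_eq_card_sub_one v).1 (by rw [hreg v, hcard, Nat.add_sub_cancel])

lemma neighborFinset_eq_compl_of_adj [DecidableEq V] (hfree : G.CliqueFree 3)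
    (hreg : G.IsRegularOfDegree d) (hcard : Fintype.card V = 2 * d) {u v : V} (huv : G.Adj u v) :
    G.neighborFinset u = (G.neighborFinset v)ᶜ := by
  refine Finset.eq_of_subset_of_card_le (fun w hw ↦ ?_) ?_
  · rw [SimpleGraph.mem_neighborFinset] at hw
    rw [Finset.mem_compl, SimpleGraph.mem_neighborFinset]
    exact fun hvw ↦ hfree _ (SimpleGraph.is3Clique_triple_iff.2 ⟨huv, hw, hvw⟩)
  · rw [Finset.card_compl, SimpleGraph.card_neighborFinset_eq_degree,
      SimpleGraph.card_neighborFinset_eq_degree, hreg u, hreg v, hcard]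
    omega

lemma adj_iff_of_cliqueFree_three (hfree : G.CliqueFree 3) (hreg : G.IsRegularOfDegree d)
    (hcard : Fintype.card V = 2 * d) (a u v : V) : G.Adj u v ↔ (G.Adj a u ↔ ¬ G.Adj a v) := by
  classical
  have hcompl := @neighborFinset_eq_compl_of_adj V _ G _ d _ hfree hreg hcard
  by_cases hau : G.Adj a u
  · have hv := Finset.ext_iff.1 (hcompl hau.symm) v
    simpa [hau] using hv
  · obtain ⟨b, hb⟩ : ∃ b, G.Adj a b := by
      rw [← G.degree_pos_iff_exists_adj, hreg a]
      have := Fintype.card_pos_iff.2 ⟨a⟩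
      omega
    have hbu := Finset.ext_iff.1 (hcompl hb.symm) u
    have hub : G.Adj u b := by simpa [hau, G.adj_comm b u] using hbu
    have hv := Finset.ext_iff.1 ((hcompl hub).trans (hcompl hb).symm) v
    simpa [hau] using hv

lemma nonempty_iso_completeBipartiteGraph [Nonempty V] (hfree : G.CliqueFree 3)
    (hreg : G.IsRegularOfDegree d) (hcard : Fintype.card V = 2 * d) :
    Nonempty (G ≃g completeBipartiteGraph (Fin d) (Fin d)) := by
  obtain ⟨a⟩ := ‹Nonempty V›
  have hN : Fintype.card {v // G.Adj a v} = d := by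
    rw [← hreg a, ← G.card_neighborSet_eq_degree]
    exact Fintype.card_congr (Equiv.refl _)
  have hN' : Fintype.card {v // ¬ G.Adj a v} = d := by
    rw [Fintype.card_subtype_compl, hN, hcard]
    omega
  let φ := ((Fintype.equivFinOfCardEq hN).sumCongr (Fintype.equivFinOfCardEq hN')).symm.trans
    (Equiv.sumCompl (G.Adj a))
  refine ⟨SimpleGraph.Iso.symm ⟨φ, fun {s t} ↦ ?_⟩⟩
  rw [adj_iff_of_cliqueFree_three hfree hreg hcard a]
  have hl : ∀ i, G.Adj a (φ (.inl i)) := fun i ↦ ((Fintype.equivFinOfCardEq hN).symm i).2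
  have hr : ∀ i, ¬ G.Adj a (φ (.inr i)) := fun i ↦ ((Fintype.equivFinOfCardEq hN').symm i).2
  cases s <;> cases t <;> simp [hl, hr]

end RegularSimpleGraphs

section SmallGraphs

variable {α β : Type*} {H : Graph α β} {A : Set α} {e f g : β} {x y z : α}

lemma isIsomorphic_S2 [H.Loopless] (hc : H.IsCubic) (hV : V(H).ncard = 2) :
    H.IsIsomorphic S2 := by
  obtain ⟨a, b, hab, hVab⟩ := ncard_eq_two.1 hV
  have hlink : ∀ (e : E(H)) (x y : V(H)), H.IsLink e x y ↔ x ≠ y := by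
    rintro ⟨e, he⟩ ⟨x, hx⟩ ⟨y, hy⟩
    obtain ⟨u, v, huv⟩ := exists_isLink_of_mem_edgeSet he
    have hu := huv.left_mem
    have hv := huv.right_mem
    have hne := huv.ne
    rw [huv.isLink_iff]
    grind
  have hE : E(H) = H.incidenceSet a := by
    refine Subset.antisymm (fun e he ↦ ?_) fun e he ↦ he.edge_mem
    exact ((hlink ⟨e, he⟩ ⟨a, by simp [hVab]⟩ ⟨b, by simp [hVab]⟩).2 (by simpa)).inc_left
  have hE3 : E(H).ncard = 3 := by rw [hE, ncard_incidenceSet hc (by simp [hVab])]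
  have : Finite V(H) := finite_of_ncard_ne_zero (by simp [hV])
  have : Finite E(H) := finite_of_ncard_ne_zero (by simp [hE3])
  have hVS2 : ∀ i, i ∈ V(S2) := fun i ↦ by fin_cases i <;> simp [S2]
  refine ⟨(Finite.equivFinOfCardEq hV).trans (Equiv.subtypeUnivEquiv hVS2).symm,
    (Finite.equivFinOfCardEq hE3).trans (Equiv.Set.univ _).symm, fun e x y ↦ ?_⟩
  have hS2 : ∀ (e : E(S2)) (i j : Fin 2), S2.IsLink e i j ↔ i ≠ j := fun e i j ↦ by
    fin_cases i <;> fin_cases j <;> simp [S2]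
  rw [hlink, hS2, not_iff_not]
  simp

lemma isIsomorphic_ofSimpleGraph [H.Simple] {V : Type*} {K : SimpleGraph V}
    (φ : H.toSimpleGraph ≃g K) : H.IsIsomorphic (ofSimpleGraph K) := by
  have hex : ∀ e : E(H), ∃ s : E(ofSimpleGraph K),
      ∀ x y : V(H), H.IsLink e x y ↔ s.1 = s(φ x, φ y) := by
    rintro ⟨e, he⟩
    obtain ⟨x, y, hxy⟩ := exists_isLink_of_mem_edgeSet he
    refine ⟨⟨s(φ ⟨x, hxy.left_mem⟩, φ ⟨y, hxy.right_mem⟩), ?_⟩, fun u v ↦ ?_⟩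
    · exact φ.map_rel_iff.2 ((toSimpleGraph_adj_iff _ _).2 hxy.adj)
    · rw [hxy.isLink_iff]
      simp [Subtype.ext_iff]
  choose ψ hψ using hex
  have hbij : Function.Bijective ψ := by
    constructor
    · intro e f hef
      obtain ⟨x, y, hxy⟩ := exists_isLink_of_mem_edgeSet e.2
      have h₁ := (hψ e ⟨x, hxy.left_mem⟩ ⟨y, hxy.right_mem⟩).1 hxy
      have h₂ := (hψ f ⟨x, hxy.left_mem⟩ ⟨y, hxy.right_mem⟩).2 (hef ▸ h₁)
      exact Subtype.ext (hxy.eq h₂)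
    · rintro ⟨s, hs⟩
      induction s with | h u v
      have hadj : H.toSimpleGraph.Adj (φ.symm u) (φ.symm v) := φ.symm.map_rel_iff.2 hs
      obtain ⟨e, he⟩ := (toSimpleGraph_adj_iff _ _).1 hadj
      refine ⟨⟨e, he.edge_mem⟩, Subtype.ext ?_⟩
      simpa using (hψ ⟨e, he.edge_mem⟩ _ _).1 he
  refine ⟨φ.toEquiv.trans (Equiv.Set.univ V).symm, Equiv.ofBijective ψ hbij, fun e x y ↦ ?_⟩
  rw [hψ]
  exact ⟨fun h ↦ ⟨h, (ψ e).2⟩, fun h ↦ h.1⟩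

lemma ncard_neighborSet_toSimpleGraph [H.Simple] (x : V(H)) :
    (H.toSimpleGraph.neighborSet x).ncard = (H.incidenceSet x).ncard := by
  refine (ncard_congr (fun e he ↦ ⟨Inc.other he, (Inc.isLink_other he).right_mem⟩)
    (fun e he ↦ ?_) (fun e f he hf hef ↦ ?_) fun y hy ↦ ?_).symm
  · exact (toSimpleGraph_adj_iff _ _).2 (Inc.isLink_other he).adj
  · have hother : Inc.other he = Inc.other hf := congrArg Subtype.val hef
    exact (Inc.isLink_other he).eq (hother ▸ Inc.isLink_other hf)
  · obtain ⟨e, he⟩ := (toSimpleGraph_adj_iff _ _).1 hy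
    exact ⟨e, he.inc_left, Subtype.ext (he.inc_left.isLink_other.right_unique he)⟩

lemma isRegularOfDegree_toSimpleGraph [H.Simple] [Fintype V(H)]
    [DecidableRel H.toSimpleGraph.Adj] (hc : H.IsCubic) :
    H.toSimpleGraph.IsRegularOfDegree 3 := fun x ↦ by
  rw [← ncard_incidenceSet hc x.2, ← ncard_neighborSet_toSimpleGraph, ncard_eq_toFinset_card',
    ← SimpleGraph.card_neighborFinset_eq_degree, SimpleGraph.neighborFinset]

lemma isIsomorphic_K4 [H.Simple] (hc : H.IsCubic) (hV : V(H).ncard = 4) : H.IsIsomorphic K4 := by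
  classical
  have : Fintype V(H) := (finite_of_ncard_ne_zero (by omega)).fintype
  have hcard : Fintype.card V(H) = 4 := by rw [← Nat.card_eq_fintype_card]; exact hV
  have htop := eq_top_of_isRegularOfDegree (isRegularOfDegree_toSimpleGraph hc) hcard
  exact isIsomorphic_ofSimpleGraph
    (htop ▸ SimpleGraph.Iso.completeGraph (Fintype.equivFinOfCardEq hcard))

lemma isIsomorphic_K33 [H.Simple] (hc : H.IsCubic) (hfree : H.toSimpleGraph.CliqueFree 3)
    (hV : V(H).ncard = 6) : H.IsIsomorphic K33 := by
  classical
  have : Fintype V(H) := (finite_of_ncard_ne_zero (by omega)).fintype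
  have hcard : Fintype.card V(H) = 2 * 3 := by rw [← Nat.card_eq_fintype_card]; exact hV
  have : Nonempty V(H) := Fintype.card_pos_iff.1 (by omega)
  obtain ⟨φ⟩ := nonempty_iso_completeBipartiteGraph hfree (isRegularOfDegree_toSimpleGraph hc) hcard
  exact isIsomorphic_ofSimpleGraph φ

lemma spansCycle_triple [H.Loopless] (he : H.IsLink e x y) (hf : H.IsLink f x z)
    (hg : H.IsLink g y z) : SpansCycle H {x, y, z} where
  subset := by
    simpa [insert_subset_iff] using ⟨he.left_mem, he.right_mem, hf.right_mem⟩
  finite := toFinite _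
  nonempty := insert_nonempty x {y, z}
  encard_le := by
    have hef : e ≠ f := by
      rintro rfl
      exact hg.ne (he.right_unique hf)
    have heg : e ≠ g := by
      rintro rfl
      exact hf.ne (he.left_unique hg.symm)
    have hfg : f ≠ g := by
      rintro rfl
      exact he.ne (hf.left_unique hg)
    calc
      ({x, y, z} : Set α).encard = ({e, f, g} : Set β).encard := by
        rw [encard_eq_three.2 ⟨x, y, z, he.ne, hf.ne, hg.ne, rfl⟩,
          encard_eq_three.2 ⟨e, f, g, hef, heg, hfg, rfl⟩]
      _ ≤ E(H.induce {x, y, z}).encard := encard_le_encard <| by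
        rintro _ (rfl | rfl | rfl)
        exacts [⟨x, y, he, by simp⟩, ⟨x, z, hf, by simp⟩, ⟨y, z, hg, by simp⟩]

lemma IsShortestCycle.cliqueFree_three [H.Loopless] (h : IsShortestCycle H A)
    (hcard : 3 < A.ncard) : H.toSimpleGraph.CliqueFree 3 := by
  classical
  intro s hs
  obtain ⟨x, y, z, hxy, hxz, hyz, -⟩ := SimpleGraph.is3Clique_iff.1 hs
  obtain ⟨e, he⟩ := (toSimpleGraph_adj_iff _ _).1 hxy
  obtain ⟨f, hf⟩ := (toSimpleGraph_adj_iff _ _).1 hxz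
  obtain ⟨g, hg⟩ := (toSimpleGraph_adj_iff _ _).1 hyz
  have hthree : ({↑x, ↑y, ↑z} : Set α).ncard = 3 :=
    ncard_eq_three.2 ⟨x, y, z, he.ne, hf.ne, hg.ne, rfl⟩
  have hle := h.ncard_le (spansCycle_triple he hf hg)
  omega

end SmallGraphs

end CubicGraph

open CubicGraph in
theorem mainTheorem6_general {α β : Type*} (H : Graph α β)
    (hcubic : H.IsCubic) (hconn : H.IsEdgeConnected 2)
    (hS2 : ¬ H.IsIsomorphic Graph.S2)
    (hK4 : ¬ H.IsIsomorphic Graph.K4)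
    (hK33 : ¬ H.IsIsomorphic Graph.K33) :
    H.IsDecomposable := by
  have := loopless_of_isCubic_of_isEdgeConnected hcubic hconn
  by_contra hnd
  obtain ⟨A, hA⟩ := exists_isShortestCycle hcubic hconn
  have hV := hA.ncard_vertexSet_add_two hcubic hconn hnd
  have hge := hA.prop.one_lt_ncard
  have hle := hA.ncard_le_four hcubic hconn hnd
  interval_cases hcard : A.ncard
  · exact hS2 (isIsomorphic_S2 hcubic (by omega))
  · have := hA.simple (by omega)
    exact hK4 (isIsomorphic_K4 hcubic (by omega))
  · have := hA.simple (by omega)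
    exact hK33 (isIsomorphic_K33 hcubic (hA.cliqueFree_three (by omega)) (by omega))

theorem mainTheorem6 {α β : Type*} (H : Graph α β)
    (hfin : V(H).Finite) (hcubic : H.IsCubic) (hconn : H.IsEdgeConnected 2)
    (hS2 : ¬ H.IsIsomorphic Graph.S2)
    (hK4 : ¬ H.IsIsomorphic Graph.K4)
    (hK33 : ¬ H.IsIsomorphic Graph.K33) :
    H.IsDecomposable :=
  mainTheorem6_general H hcubic hconn hS2 hK4 hK33
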